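/- Let $p$ be a prime, let $q=p^e>3$ be an odd prime power, and let $\mathbb F_q$ be the field with $q$ elements. Let $V_n=(\mathbb C^q)^{\otimes n}$ be the Hilbert space with orthonormal basis $|x\rangle$, $x\in\mathbb F_q^n$. For $a,b\in\mathbb F_q^n$ let $X(a)|x\rangle=|x+a\rangle$ and $Z(b)|x\rangle=\omega^{\sum_i \mathrm{tr}(b_ix_i)}|x\rangle$, where $\omega=e^{2\pi i/p}$ and $\mathrm{tr}$ is the trace from $\mathbb F_q$ to $\mathbb F_p$. The errors are the operators $E=\omega^cX(a)Z(b)$ with $c\in\mathbb F_p$ and $a,b\in\mathbb F_q^n$, and the weight of such an $E$ is the number of $i$ with $(a_i,b_i)\neq(0,0)$. A subspace $Q\subseteq V_n$ detects $t$ errors if $\langle u|E|v\rangle=0$ for all $u,v\in Q$ with $\langle u|v\rangle=0$ and all errors $E$ of weight at most $t$ and, in case $\dim Q=1$, also $\langle u|E|v\rangle=0$ for all $u,v\in Q$ and all errors $E$ of weight between $1$ and $t$. An $[[n,k,d]]_q$ quantum code is a subspace $Q\subseteq V_n$ of dimension $q^k$ that detects $d-1$ errors, where $d\ge 1$ is the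 largest integer with this property; it is a quantum MDS code if $2d=n-k+2$. (1) For every integer $k$ with $\lceil\frac{q+2}{2}\rceil\le k\le q+1$ there exists a $[[q+1,\,2k-q-1,\,q-k+2]]_q$ quantum MDS code. (2) There exists a $[[q+1,\,0,\,\frac{q+1}{2}+1]]_q$ quantum MDS code. -/

import Mathlib

namespace QuantumCode

/-- The state space `V_n = ℂ^q ⊗ ⋯ ⊗ ℂ^q = ℂ^(q^n)`, in coordinates with respect to its orthonormal
basis `|c⟩`, `c ∈ F^n`, where `F` is the field with `q` elements. -/
abbrev StateSpace (F : Type*) [Fintype F] (n : ℕ) : Type _ :=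
  EuclideanSpace ℂ (Fin n → F)

section Operators

variable {F : Type*} [Field F] [Fintype F] {n : ℕ}

/-- The basis vector `|c⟩ = |c₁⟩ ⊗ ⋯ ⊗ |cₙ⟩`. -/
noncomputable def ket [DecidableEq F] (c : Fin n → F) : StateSpace F n :=
  EuclideanSpace.single c 1

/-- The operator `X(a) = X(a₁) ⊗ ⋯ ⊗ X(aₙ)`, that is, `X(a)|x⟩ = |x + a⟩`
(see `shiftX_ket`). -/
noncomputable def shiftX (a : Fin n → F) : StateSpace F n →ₗ[ℂ] StateSpace F n where
  toFun v := WithLp.toLp 2 fun x => v (x - a)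
  map_add' _ _ := rfl
  map_smul' _ _ := rfl

theorem shiftX_apply (a : Fin n → F) (v : StateSpace F n) (x : Fin n → F) :
    shiftX a v x = v (x - a) := rfl

theorem shiftX_ket [DecidableEq F] (a x : Fin n → F) : shiftX a (ket x) = ket (x + a) := by
  ext y
  simp [shiftX_apply, ket, sub_eq_iff_eq_add]

variable (p : ℕ) [Fact p.Prime] [Algebra (ZMod p) F]

/-- The phase `ω^{tr(b x)}`, where `ω = exp(2πi/p)` and `tr` is the trace map from `F` to `F_p`;
`ZMod.stdAddChar` is `j ↦ exp(2πi j/p)`. -/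
noncomputable def phase (b x : F) : ℂ :=
  ZMod.stdAddChar (Algebra.trace (ZMod p) F (b * x))

/-- The operator `Z(b) = Z(b₁) ⊗ ⋯ ⊗ Z(bₙ)`, that is,
`Z(b)|x⟩ = (∏ i, ω^{tr(bᵢ xᵢ)}) |x⟩` (see `clockZ_ket`). -/
noncomputable def clockZ (b : Fin n → F) : StateSpace F n →ₗ[ℂ] StateSpace F n where
  toFun v := WithLp.toLp 2 fun x => (∏ i, phase p (b i) (x i)) * v x
  map_add' v w := by ext x; simp [mul_add]
  map_smul' c v := by ext x; simp [mul_left_comm]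

theorem clockZ_ket [DecidableEq F] (b x : Fin n → F) :
    clockZ p b (ket x) = (∏ i, phase p (b i) (x i)) • ket x := by
  ext y
  by_cases h : y = x
  · subst h; simp [clockZ, ket]
  · simp [clockZ, ket, h]

/-- The element `ω^c X(a) Z(b)` of the error group `G_n`, for `c ∈ F_p` and `a, b ∈ F^n`. -/
noncomputable def errorOp (c : ZMod p) (a b : Fin n → F) :
    StateSpace F n →ₗ[ℂ] StateSpace F n :=
  (ZMod.stdAddChar c : ℂ) • (shiftX a ∘ₗ clockZ p b)

/-- The quantum weight of `ω^c X(a) Z(b)`: the number of positions `i` with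
`(aᵢ, bᵢ) ≠ (0, 0)`. -/
def errorWeight [DecidableEq F] (a b : Fin n → F) : ℕ :=
  hammingNorm fun i => (a i, b i)

/-- `⟨u|e|v⟩ = 0` for all orthogonal `u, v ∈ Q` and all errors `e ∈ G_n` of weight at most `t`. -/
def OrthogonalUpTo [DecidableEq F] (Q : Submodule ℂ (StateSpace F n)) (t : ℕ) : Prop :=
  ∀ u ∈ Q, ∀ v ∈ Q, inner ℂ u v = 0 →
    ∀ (c : ZMod p) (a b : Fin n → F), errorWeight a b ≤ t →
      inner ℂ u (errorOp p c a b v) = 0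

/-- `⟨u|e|v⟩ = 0` for all `u, v ∈ Q` and all errors `e ∈ G_n` of weight between `1` and `t`. -/
def PureUpTo [DecidableEq F] (Q : Submodule ℂ (StateSpace F n)) (t : ℕ) : Prop :=
  ∀ u ∈ Q, ∀ v ∈ Q,
    ∀ (c : ZMod p) (a b : Fin n → F), 1 ≤ errorWeight a b → errorWeight a b ≤ t →
      inner ℂ u (errorOp p c a b v) = 0

/-- `Q` detects `t` errors. For a one-dimensional `Q` the orthogonality condition is void, and by
the usual convention such a code is required to be pure. -/
def Detects [DecidableEq F] (Q : Submodule ℂ (StateSpace F n)) (t : ℕ) : Prop :=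
  OrthogonalUpTo p Q t ∧ (Module.finrank ℂ Q = 1 → PureUpTo p Q t)

/-- `Q` is an `[[n, k, d]]_q` quantum code: it has dimension `q^k`, it detects `d - 1` errors, and
`d ≥ 1` is the largest number with this property. -/
structure HasParameters [DecidableEq F] (Q : Submodule ℂ (StateSpace F n)) (k d : ℕ) : Prop where
  finrank_eq : Module.finrank ℂ Q = Fintype.card F ^ k
  one_le : 1 ≤ d
  detects : Detects p Q (d - 1)
  not_detects : ¬ Detects p Q d

/-- `Q` is an `[[n, k, d]]_q` quantum MDS code: it attains the quantum Singleton bound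
`2 d ≤ n - k + 2`. -/
structure IsMDS [DecidableEq F] (Q : Submodule ℂ (StateSpace F n)) (k d : ℕ) : Prop where
  hasParameters : HasParameters p Q k d
  singleton_eq : 2 * (d : ℤ) = (n : ℤ) - (k : ℤ) + 2

end Operators

end QuantumCode

/-! Write n = q + 1 = 2r + k; the distance wanted is r + 1, and k is even because q is odd. For a
nonsquare a, the polynomial h = (X² - a)^(k/2) is monic of degree k and has no root in F. Let C₁
(`projRS`) be the values on the projective line of all polynomials of degree < r + k, and C₂ ≤ C₁
(`projRSMul`) those of the multiples h * f with deg f < r. As h vanishes nowhere, infinity included,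
C₂ is the projective Reed-Solomon code of dimension r with rescaled coordinates. Counting zeros,
nonzero words of C₁ have weight > r (`eq_zero_of_mem_projRS`); by interpolation, so do nonzero words
orthogonal to C₂ (`exists_dotProduct_projRSMul_ne_zero`).

The CSS code of C₂ ≤ C₁ has dimension q^k. A nontrivial error of weight at most r either shifts by a
vector outside C₁ or is a pure phase error not orthogonal to C₂, and both kinds map the code to an
orthogonal space (`pureUpTo_cssCode`). A word of C₁ of weight at most r + 1, outside C₂ when k ≠ 0,
gives an undetected shift, so the distance is exactly r + 1 (`hasParameters_cssCode`). -/

namespace QuantumCode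

/-! ### CSS codes: dimension, purity and distance -/

section CSS

variable {F : Type*} [Field F] [Fintype F] {n : ℕ}

/-- The CSS code of `C₂ ≤ C₁`: the states supported on `C₁` that are invariant under translation
by `C₂`, that is, the span of the states `∑ c ∈ C₂, |x + c⟩` with `x ∈ C₁`. -/
def cssCode (C₁ C₂ : Submodule F (Fin n → F)) : Submodule ℂ (StateSpace F n) where
  carrier := {v | (∀ x, x ∉ C₁ → v x = 0) ∧ ∀ c ∈ C₂, ∀ x, v (x + c) = v x}
  zero_mem' := by simp
  add_mem' := by
    rintro v w ⟨hv, hv'⟩ ⟨hw, hw'⟩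
    exact ⟨fun x hx => by simp [hv x hx, hw x hx], fun c hc x => by simp [hv' c hc x, hw' c hc x]⟩
  smul_mem' := by
    rintro z v ⟨hv, hv'⟩
    exact ⟨fun x hx => by simp [hv x hx], fun c hc x => by simp [hv' c hc x]⟩

/-- A state of the CSS code is a function on `C₁ ⧸ C₂`. -/
noncomputable def cssCodeEquiv (C₁ C₂ : Submodule F (Fin n → F)) (h : C₂ ≤ C₁) :
    cssCode C₁ C₂ ≃ₗ[ℂ] (C₁ ⧸ C₂.submoduleOf C₁ → ℂ) where
  toFun v := fun y => Quotient.liftOn' y (fun x : C₁ => v.1 (x : Fin n → F)) (by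
    intro x y hxy
    have hc : (y : Fin n → F) - x ∈ C₂ := by
      have := (C₂.submoduleOf C₁).neg_mem ((Submodule.quotientRel_def _).1 hxy)
      rw [neg_sub] at this
      exact this
    have := v.2.2 _ hc x
    simpa using this.symm)
  map_add' v w := by
    ext y
    induction y using Submodule.Quotient.induction_on with | _ y => rfl
  map_smul' z v := by
    ext y
    induction y using Submodule.Quotient.induction_on with | _ y => rfl
  invFun g := by
    classical
    exact ⟨WithLp.toLp 2 fun x => if hx : x ∈ C₁ then g (Submodule.Quotient.mk ⟨x, hx⟩) else 0, by
      refine ⟨fun x hx => by simp [hx], fun c hc x => ?_⟩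
      by_cases hx : x ∈ C₁
      · have hxc : x + c ∈ C₁ := C₁.add_mem hx (h hc)
        simp only [hx, hxc, dite_true]
        congr 1
        rw [Submodule.Quotient.eq]
        change x + c - x ∈ C₂
        rwa [add_sub_cancel_left]
      · have hxc : x + c ∉ C₁ := fun hxc => hx (by simpa using C₁.sub_mem hxc (h hc))
        simp [hx, hxc]⟩
  left_inv v := by
    ext x
    by_cases hx : x ∈ C₁
    · simp only [hx, dite_true]
      rfl
    · simp [hx, v.2.1 x hx]
  right_inv g := by
    ext y
    induction y using Submodule.Quotient.induction_on with | _ y =>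
      simp only [Submodule.Quotient.mk, Quotient.liftOn'_mk'', y.2, dite_true]

theorem finrank_cssCode {C₁ C₂ : Submodule F (Fin n → F)} (h : C₂ ≤ C₁) {k : ℕ}
    (hk : Module.finrank F C₁ = Module.finrank F C₂ + k) :
    Module.finrank ℂ (cssCode C₁ C₂) = Fintype.card F ^ k := by
  classical
  have := Fintype.ofFinite (C₁ ⧸ C₂.submoduleOf C₁)
  rw [(cssCodeEquiv C₁ C₂ h).finrank_eq, Module.finrank_fintype_fun_eq_card,
    Module.card_eq_pow_finrank (K := F)]
  congr 1
  have h₁ := Submodule.finrank_quotient_add_finrank (C₂.submoduleOf C₁)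
  have h₂ := (Submodule.submoduleOfEquivOfLe h).finrank_eq
  omega

variable (p : ℕ) [Fact p.Prime] [Algebra (ZMod p) F]

theorem prod_phase (b x : Fin n → F) :
    ∏ i, phase p (b i) (x i) = ZMod.stdAddChar (Algebra.trace (ZMod p) F (b ⬝ᵥ x)) := by
  simp only [phase, dotProduct, map_sum]
  exact (map_prod (ZMod.stdAddChar (N := p)).toMonoidHom
    (fun i => Multiplicative.ofAdd (Algebra.trace (ZMod p) F (b i * x i))) Finset.univ).symm

theorem errorOp_apply (c : ZMod p) (a b : Fin n → F) (v : StateSpace F n) (x : Fin n → F) :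
    errorOp p c a b v x = ZMod.stdAddChar c *
      (ZMod.stdAddChar (Algebra.trace (ZMod p) F (b ⬝ᵥ (x - a))) * v (x - a)) := by
  rw [← prod_phase]
  rfl

theorem inner_errorOp (c : ZMod p) (a b : Fin n → F) (u v : StateSpace F n) :
    inner ℂ u (errorOp p c a b v) = ∑ x, ZMod.stdAddChar c *
      (ZMod.stdAddChar (Algebra.trace (ZMod p) F (b ⬝ᵥ (x - a))) * v (x - a)) *
        starRingEnd ℂ (u x) := by
  simp [PiLp.inner_apply, errorOp_apply]

variable {p}

/-- An error that shifts by a vector outside `C₁` maps the CSS code to an orthogonal space. -/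
theorem inner_errorOp_eq_zero_of_notMem {C₁ C₂ : Submodule F (Fin n → F)} {a : Fin n → F}
    (ha : a ∉ C₁) (b : Fin n → F) (c : ZMod p) {u v : StateSpace F n} (hu : u ∈ cssCode C₁ C₂)
    (hv : v ∈ cssCode C₁ C₂) : inner ℂ u (errorOp p c a b v) = 0 := by
  rw [inner_errorOp]
  refine Finset.sum_eq_zero fun x _ => ?_
  by_cases hx : x ∈ C₁
  · have : x - a ∉ C₁ := fun h => ha (by simpa using C₁.sub_mem hx h)
    simp [hv.1 _ this]
  · simp [hu.1 _ hx]

/-- `C` is closed under scalars from `F`, so the nonzero product can be scaled to any element of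
`F`, in particular to one of nonzero trace. -/
theorem exists_trace_smul_ne_zero {C : Submodule F (Fin n → F)} {b c : Fin n → F} (hc : c ∈ C)
    (hbc : b ⬝ᵥ c ≠ 0) : ∃ c' ∈ C, Algebra.trace (ZMod p) F (b ⬝ᵥ c') ≠ 0 := by
  obtain ⟨s, hs⟩ : ∃ s, Algebra.trace (ZMod p) F s ≠ 0 := by
    obtain ⟨s, hs⟩ := Algebra.trace_surjective (ZMod p) F 1
    exact ⟨s, by simp [hs]⟩
  refine ⟨(s / (b ⬝ᵥ c)) • c, C.smul_mem _ hc, ?_⟩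
  rwa [dotProduct_smul, smul_eq_mul, div_mul_cancel₀ _ hbc]

/-- A phase error by a vector not orthogonal to `C₂` maps the CSS code to an orthogonal space. -/
theorem inner_errorOp_zero_eq_zero {C₁ C₂ : Submodule F (Fin n → F)} {b : Fin n → F}
    (hb : ∃ c ∈ C₂, b ⬝ᵥ c ≠ 0) (c : ZMod p) {u v : StateSpace F n} (hu : u ∈ cssCode C₁ C₂)
    (hv : v ∈ cssCode C₁ C₂) : inner ℂ u (errorOp p c 0 b v) = 0 := by
  obtain ⟨w, hw, hbw⟩ := hb
  obtain ⟨y, hy, hby⟩ := exists_trace_smul_ne_zero (p := p) hw hbw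
  set z : ℂ := ZMod.stdAddChar (Algebra.trace (ZMod p) F (b ⬝ᵥ y)) with hz
  have hz1 : z ≠ 1 := fun h => hby (ZMod.injective_stdAddChar (by
    rw [AddChar.map_zero_eq_one]; exact h))
  have key : inner ℂ u (errorOp p c 0 b v) = z * inner ℂ u (errorOp p c 0 b v) := by
    -- Translating the summation variable by `y ∈ C₂` fixes `u` and `v` and multiplies the phase by
    -- `z ≠ 1`, so the inner product must vanish.
    conv_lhs => rw [inner_errorOp, ← Equiv.sum_comp (Equiv.addRight y)]
    rw [inner_errorOp, Finset.mul_sum]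
    refine Finset.sum_congr rfl fun x _ => ?_
    simp only [Equiv.coe_addRight, sub_zero, hv.2 y hy x, hu.2 y hy x, dotProduct_add, map_add,
      AddChar.map_add_eq_mul, hz]
    ring
  have : (z - 1) * inner ℂ u (errorOp p c 0 b v) = 0 := by rw [sub_mul, ← key, one_mul, sub_self]
  exact (mul_eq_zero.1 this).resolve_left (sub_ne_zero.2 hz1)

variable [DecidableEq F]

theorem hammingNorm_le_errorWeight_left (a b : Fin n → F) : hammingNorm a ≤ errorWeight a b := by
  rw [errorWeight, hammingNorm, hammingNorm]
  refine Finset.card_le_card fun i => ?_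
  simp +contextual [Prod.ext_iff]

theorem hammingNorm_le_errorWeight_right (a b : Fin n → F) : hammingNorm b ≤ errorWeight a b := by
  rw [errorWeight, hammingNorm, hammingNorm]
  refine Finset.card_le_card fun i => ?_
  simp +contextual [Prod.ext_iff]

theorem errorWeight_zero_right (a : Fin n → F) : errorWeight a 0 = hammingNorm a := by
  simp [errorWeight, hammingNorm, Prod.ext_iff]

theorem pureUpTo_cssCode {C₁ C₂ : Submodule F (Fin n → F)} {r : ℕ}
    (hX : ∀ a ∈ C₁, hammingNorm a ≤ r → a = 0)
    (hZ : ∀ b : Fin n → F, hammingNorm b ≤ r → b ≠ 0 → ∃ c ∈ C₂, b ⬝ᵥ c ≠ 0) :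
    PureUpTo p (cssCode C₁ C₂) r := by
  intro u hu v hv c a b h₁ hr
  by_cases ha : a = 0
  · subst ha
    refine inner_errorOp_zero_eq_zero
      (hZ b ((hammingNorm_le_errorWeight_right 0 b).trans hr) ?_) c hu hv
    rintro rfl
    simp [errorWeight_zero_right] at h₁
  · exact inner_errorOp_eq_zero_of_notMem
      (fun h => ha (hX a h ((hammingNorm_le_errorWeight_left a b).trans hr))) b c hu hv

/-- Only errors of weight 0 are not covered by purity, and these are scalars. -/
theorem PureUpTo.orthogonalUpTo {Q : Submodule ℂ (StateSpace F n)} {t : ℕ}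
    (h : PureUpTo p Q t) : OrthogonalUpTo p Q t := by
  intro u hu v hv huv c a b ht
  rcases Nat.eq_zero_or_pos (errorWeight a b) with h0 | h1
  · have hab := hammingNorm_eq_zero.1 h0
    obtain rfl : a = 0 := funext fun i => congrArg Prod.fst (congrFun hab i)
    obtain rfl : b = 0 := funext fun i => congrArg Prod.snd (congrFun hab i)
    have : errorOp p c 0 0 v = (ZMod.stdAddChar c : ℂ) • v := by
      ext x
      simp [errorOp_apply]
    rw [this, inner_smul_right, huv, mul_zero]
  · exact h u hu v hv c a b h1 ht

/-- Detection fails at the weight of a nonzero word of `C₁`, provided that it lies outside `C₂` in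
case the CSS code has dimension more than one. -/
theorem not_detects_cssCode {C₁ C₂ : Submodule F (Fin n → F)} (h : C₂ ≤ C₁) {w : Fin n → F}
    (hw : w ∈ C₁) (hw0 : w ≠ 0)
    (hw₂ : Module.finrank ℂ (cssCode C₁ C₂) = 1 ∨ w ∉ C₂) {t : ℕ} (ht : hammingNorm w ≤ t) :
    ¬ Detects p (cssCode C₁ C₂) t := by
  classical
  rintro ⟨hO, hP⟩
  -- `v` is the indicator of `C₂` and `u` below that of `w + C₂`. The shift by `w` takes `v` to `u`,
  -- so its matrix element is `⟨u|u⟩ ≠ 0`; if `w ∉ C₂`, the two cosets are disjoint and `u` is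
  -- orthogonal to `v`.
  let v : StateSpace F n := WithLp.toLp 2 fun x => if x ∈ C₂ then 1 else 0
  have hvx (x) : v x = if x ∈ C₂ then 1 else 0 := rfl
  have hv : v ∈ cssCode C₁ C₂ := by
    refine ⟨fun x hx => ?_, fun c hc x => ?_⟩
    · rw [hvx, if_neg fun hx' => hx (h hx')]
    · simp only [hvx, C₂.add_mem_iff_left hc]
  let u := errorOp p 0 w 0 v
  have hux (x) : u x = v (x - w) := by simp [u, errorOp_apply]
  have hu : u ∈ cssCode C₁ C₂ := by
    refine ⟨fun x hx => ?_, fun c hc x => ?_⟩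
    · rw [hux]
      exact hv.1 _ fun hx' => hx (by simpa using C₁.add_mem hx' hw)
    · rw [hux, hux, add_sub_right_comm, hv.2 c hc]
  have hu0 : u ≠ 0 := fun hu0 => by
    have : u w = 0 := by simp [hu0]
    simp [hux, hvx] at this
  have hne : inner ℂ u u ≠ 0 := inner_self_ne_zero.2 hu0
  rcases hw₂ with h1 | hw₂
  · refine hne (hP h1 u hu v hv 0 w 0 ?_ ?_)
    · rw [errorWeight_zero_right, Nat.one_le_iff_ne_zero]
      exact hammingNorm_ne_zero_iff.2 hw0
    · rwa [errorWeight_zero_right]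
  · refine hne (hO u hu v hv ?_ 0 w 0 (by rwa [errorWeight_zero_right]))
    rw [PiLp.inner_apply]
    refine Finset.sum_eq_zero fun x _ => ?_
    rw [hux, hvx, hvx]
    by_cases hx : x ∈ C₂
    · have : x - w ∉ C₂ := fun h' => hw₂ (by simpa using C₂.sub_mem hx h')
      simp [this]
    · simp [hx]

theorem hasParameters_cssCode {C₁ C₂ : Submodule F (Fin n → F)} (h : C₂ ≤ C₁) {k r : ℕ}
    (hk : Module.finrank F C₁ = Module.finrank F C₂ + k)
    (hX : ∀ a ∈ C₁, hammingNorm a ≤ r → a = 0)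
    (hZ : ∀ b : Fin n → F, hammingNorm b ≤ r → b ≠ 0 → ∃ c ∈ C₂, b ⬝ᵥ c ≠ 0)
    {w : Fin n → F} (hw : w ∈ C₁) (hw0 : w ≠ 0) (hwr : hammingNorm w ≤ r + 1)
    (hw₂ : k ≠ 0 → w ∉ C₂) :
    HasParameters p (cssCode C₁ C₂) k (r + 1) where
  finrank_eq := finrank_cssCode h hk
  one_le := by omega
  detects := ⟨(pureUpTo_cssCode hX hZ).orthogonalUpTo, fun _ => pureUpTo_cssCode hX hZ⟩
  not_detects := by
    refine not_detects_cssCode h hw hw0 ?_ hwr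
    rcases eq_or_ne k 0 with rfl | hk0
    · exact Or.inl (by rw [finrank_cssCode h hk, pow_zero])
    · exact Or.inr (hw₂ hk0)

end CSS

end QuantumCode

namespace QuantumCode

/-! ### Projective Reed-Solomon codes -/

section ProjectiveReedSolomon

open Polynomial

variable {F : Type*} [Field F] {n : ℕ}

/-- Evaluation of a polynomial of degree less than `m` at the points of the projective line, the
value at infinity being the coefficient of `X ^ (m - 1)`. -/
noncomputable def projEval (e : Fin n ≃ Option F) (m : ℕ) : F[X] →ₗ[F] (Fin n → F) :=
  LinearMap.pi fun i => (e i).elim (lcoeff F (m - 1)) leval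

theorem projEval_some {e : Fin n ≃ Option F} {m : ℕ} (f : F[X]) {i : Fin n} {x : F}
    (hi : e i = some x) : projEval e m f i = f.eval x := by
  simp [projEval, hi]

theorem projEval_none {e : Fin n ≃ Option F} {m : ℕ} (f : F[X]) {i : Fin n}
    (hi : e i = none) : projEval e m f i = f.coeff (m - 1) := by
  simp [projEval, hi]

/-- A polynomial of degree less than `m` with `m` zeros on the projective line vanishes. -/
theorem eq_zero_of_projEval_eq_zero (e : Fin n ≃ Option F) {m : ℕ} {f : F[X]}
    (hf : f ∈ degreeLT F m) (S : Finset (Fin n)) (hS : m ≤ S.card)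
    (h : ∀ i ∈ S, projEval e m f i = 0) : f = 0 := by
  classical
  rw [mem_degreeLT] at hf
  let T : Finset F := (S.map e.toEmbedding).eraseNone
  have hT : ∀ x ∈ T, f.eval x = 0 := by
    intro x hx
    simp only [T, Finset.mem_eraseNone, Finset.mem_map_equiv] at hx
    rw [← h _ hx]
    exact (projEval_some f (by simp)).symm
  -- A zero at infinity costs one affine zero but lowers the degree bound to `m - 1`, so the root
  -- count still suffices.
  by_cases hnone : none ∈ S.map e.toEmbedding
  · have hcard : T.card + 1 = S.card := by
      have : T.card = _ := Finset.card_eraseNone_eq_card_erase (S.map e.toEmbedding)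
      rw [Finset.card_erase_of_mem hnone, Finset.card_map] at this
      have hpos : 0 < S.card := by
        rw [← Finset.card_map e.toEmbedding]; exact Finset.card_pos.2 ⟨_, hnone⟩
      omega
    have hc : f.coeff (m - 1) = 0 := by
      rw [Finset.mem_map_equiv] at hnone
      rw [← h _ hnone]
      exact (projEval_none f (by simp)).symm
    refine Polynomial.eq_zero_of_degree_lt_of_eval_finset_eq_zero T ?_ hT
    refine lt_of_lt_of_le ((degree_lt_iff_coeff_zero f (m - 1)).2 fun j hj => ?_)
      (Nat.cast_le.2 (by omega : m - 1 ≤ T.card))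
    rcases hj.eq_or_lt with rfl | hj
    · exact hc
    · exact (degree_lt_iff_coeff_zero f m).1 hf j (by omega)
  · have hcard : T.card = S.card := by
      have := Finset.card_eraseNone_eq_card_erase (S.map e.toEmbedding)
      rwa [Finset.erase_eq_of_notMem hnone, Finset.card_map] at this
    exact Polynomial.eq_zero_of_degree_lt_of_eval_finset_eq_zero T
      (hf.trans_le (Nat.cast_le.2 (by omega))) hT

/-- For fewer than `m` points and one further point of the projective line, some polynomial of
degree less than `m` vanishes at the former but not at the latter. -/
theorem exists_projEval_ne_zero (e : Fin n ≃ Option F) {m : ℕ} (S : Finset (Fin n))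
    (hS : S.card < m) {i : Fin n} (hi : i ∉ S) :
    ∃ f ∈ degreeLT F m, projEval e m f i ≠ 0 ∧ ∀ j ∈ S, projEval e m f j = 0 := by
  classical
  let T : Finset F := (S.map e.toEmbedding).eraseNone
  have hmemT (x : F) : x ∈ T ↔ e.symm (some x) ∈ S := by
    simp [T, Finset.mem_map_equiv]
  have hcard := Finset.card_eraseNone_eq_card_erase (S.map e.toEmbedding)
  change T.card = _ at hcard
  let g : F[X] := ∏ x ∈ T, (X - C x)
  have hg : g.Monic := monic_prod_of_monic _ _ fun x _ => monic_X_sub_C x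
  have hgdeg : g.natDegree = T.card := by
    simp [g, natDegree_prod_of_monic T (fun x => X - C x) fun x _ => monic_X_sub_C x]
  have hgroot (x : F) : g.eval x = 0 ↔ x ∈ T := by
    simp [g, eval_prod, Finset.prod_eq_zero_iff, sub_eq_zero]
  have hzero {f : F[X]} (hgf : g ∣ f) {j : Fin n} {x : F} (hj : j ∈ S) (hx : e j = some x) :
      projEval e m f j = 0 := by
    rw [projEval_some f hx]
    refine eval_eq_zero_of_dvd_of_eval_eq_zero hgf ((hgroot x).2 ((hmemT x).2 ?_))
    rwa [← hx, e.symm_apply_apply]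
  cases hei : e i with
  | none =>
    have hnone : none ∉ S.map e.toEmbedding := by
      rwa [Finset.mem_map_equiv, ← hei, e.symm_apply_apply]
    rw [Finset.erase_eq_of_notMem hnone, Finset.card_map] at hcard
    -- Padding to degree exactly `m - 1` makes the value at infinity the leading coefficient 1.
    have hmon : (g * X ^ (m - 1 - T.card)).Monic := hg.mul (monic_X_pow _)
    have hdeg : (g * X ^ (m - 1 - T.card)).natDegree = m - 1 := by
      rw [hg.natDegree_mul (monic_X_pow _), hgdeg, natDegree_X_pow]
      omega
    refine ⟨g * X ^ (m - 1 - T.card), ?_, ?_, fun j hj => ?_⟩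
    · rw [mem_degreeLT, degree_eq_natDegree hmon.ne_zero, hdeg]
      exact Nat.cast_lt.2 (by omega)
    · have := hmon.coeff_natDegree
      rw [hdeg] at this
      rw [projEval_none _ hei, this]
      exact one_ne_zero
    · cases hej : e j with
      | none => exact absurd (e.injective (hei.trans hej.symm) ▸ hj) hi
      | some x => exact hzero (dvd_mul_right _ _) hj hej
  | some y =>
    have hy : y ∉ T := by rwa [hmemT, ← hei, e.symm_apply_apply]
    have hTm : T.card ≤ S.card := by
      rw [hcard, ← Finset.card_map e.toEmbedding]
      exact Finset.card_erase_le
    refine ⟨g, ?_, ?_, fun j hj => ?_⟩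
    · rw [mem_degreeLT, degree_eq_natDegree hg.ne_zero, hgdeg]
      exact Nat.cast_lt.2 (by omega)
    · rwa [projEval_some _ hei, Ne, hgroot]
    · cases hej : e j with
      | none =>
        rw [projEval_none _ hej]
        -- With infinity in `S`, the degree of `g` is `S.card - 1 < m - 1`, so `g` vanishes at
        -- infinity too.
        refine coeff_eq_zero_of_natDegree_lt ?_
        have hnone : none ∈ S.map e.toEmbedding := by
          rwa [Finset.mem_map_equiv, ← hej, e.symm_apply_apply]
        rw [Finset.card_erase_of_mem hnone, Finset.card_map] at hcard
        have : 0 < S.card := Finset.card_pos.2 ⟨j, hj⟩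
        omega
      | some x => exact hzero dvd_rfl hj hej

/-- The projective Reed-Solomon code of dimension `m`. -/
noncomputable def projRS (e : Fin n ≃ Option F) (m : ℕ) : Submodule F (Fin n → F) :=
  (degreeLT F m).map (projEval e m)

/-- The words of the projective Reed-Solomon code of dimension `m` that come from the multiples
`f * h` with `f` of degree less than `r`. -/
noncomputable def projRSMul (e : Fin n ≃ Option F) (h : F[X]) (r m : ℕ) :
    Submodule F (Fin n → F) :=
  ((degreeLT F r).map (LinearMap.mulLeft F h)).map (projEval e m)

theorem finrank_degreeLT (m : ℕ) : Module.finrank F (degreeLT F m) = m := by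
  simp [(degreeLTEquiv F m).finrank_eq]

theorem injOn_projEval (e : Fin n ≃ Option F) {m : ℕ} (hm : m ≤ n) :
    Set.InjOn (projEval e m) (degreeLT F m) := by
  intro f hf g hg hfg
  rw [← sub_eq_zero]
  refine eq_zero_of_projEval_eq_zero e ((degreeLT F m).sub_mem hf hg) Finset.univ (by simpa) ?_
  intro i _
  rw [map_sub, hfg, sub_self, Pi.zero_apply]

theorem finrank_map_of_injOn {V W : Type*} [AddCommGroup V] [Module F V] [AddCommGroup W]
    [Module F W] (φ : V →ₗ[F] W) {U : Submodule F V} (h : Set.InjOn φ U) :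
    Module.finrank F (U.map φ) = Module.finrank F U := by
  rw [← LinearMap.range_domRestrict]
  exact LinearMap.finrank_range_of_inj fun x y hxy => Subtype.ext (h x.2 y.2 hxy)

theorem finrank_projRS (e : Fin n ≃ Option F) {m : ℕ} (hm : m ≤ n) :
    Module.finrank F (projRS e m) = m := by
  rw [projRS, finrank_map_of_injOn _ (injOn_projEval e hm), finrank_degreeLT]

theorem map_mulLeft_degreeLT_le {h : F[X]} {r m : ℕ} (hdeg : r + h.natDegree ≤ m) :
    (degreeLT F r).map (LinearMap.mulLeft F h) ≤ degreeLT F m := by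
  rintro _ ⟨f, hf, rfl⟩
  rw [SetLike.mem_coe, mem_degreeLT] at hf
  rw [LinearMap.mulLeft_apply, mem_degreeLT]
  by_cases hf0 : f = 0
  · simp [hf0]
  have hfr : f.natDegree < r := (natDegree_lt_iff_degree_lt hf0).2 hf
  refine degree_le_natDegree.trans_lt (Nat.cast_lt.2 ?_)
  have := natDegree_mul_le (p := h) (q := f)
  omega

theorem projRSMul_le (e : Fin n ≃ Option F) {h : F[X]} {r m : ℕ} (hdeg : r + h.natDegree ≤ m) :
    projRSMul e h r m ≤ projRS e m :=
  Submodule.map_mono (map_mulLeft_degreeLT_le hdeg)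

theorem finrank_projRSMul (e : Fin n ≃ Option F) {h : F[X]} (h0 : h ≠ 0) {r m : ℕ}
    (hdeg : r + h.natDegree ≤ m) (hm : m ≤ n) :
    Module.finrank F (projRSMul e h r m) = r := by
  rw [projRSMul, finrank_map_of_injOn _
    ((injOn_projEval e hm).mono (map_mulLeft_degreeLT_le hdeg)),
    finrank_map_of_injOn _ (fun f _ g _ hfg => mul_left_cancel₀ h0 hfg), finrank_degreeLT]

/-- Multiplication by a monic polynomial `h` multiplies the values on the projective line by those
of `h`, the value of `h` at infinity being `1`. -/
theorem projEval_mul (e : Fin n ≃ Option F) {h : F[X]} (hmon : h.Monic) {r : ℕ} (hr : r ≠ 0)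
    {f : F[X]} (hf : f ∈ degreeLT F r) (i : Fin n) :
    projEval e (r + h.natDegree) (h * f) i =
      (e i).elim 1 (fun x => h.eval x) * projEval e r f i := by
  cases hi : e i with
  | some x => simp [projEval_some _ hi]
  | none =>
    rw [projEval_none _ hi, projEval_none _ hi]
    rw [mem_degreeLT] at hf
    have hfr : f.natDegree ≤ r - 1 := natDegree_le_of_degree_le (by
      rw [degree_le_iff_coeff_zero]
      intro j hj
      refine (degree_lt_iff_coeff_zero f r).1 hf j ?_
      have := Nat.cast_lt.1 hj
      omega)
    -- Here `r ≠ 0` matters: the top coefficient of the product is then the product of the top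
    -- coefficients.
    rw [show r + h.natDegree - 1 = h.natDegree + (r - 1) by omega,
      coeff_mul_add_eq_of_natDegree_le le_rfl hfr, hmon.coeff_natDegree]
    rfl

variable [DecidableEq F]

theorem card_filter_eq_zero (a : Fin n → F) :
    (Finset.univ.filter fun i => a i = 0).card + hammingNorm a = n := by
  rw [hammingNorm, Finset.card_filter_add_card_filter_not]
  simp

theorem eq_zero_of_mem_projRS (e : Fin n ≃ Option F) {m r : ℕ} (hm : m + r ≤ n) {a : Fin n → F}
    (ha : a ∈ projRS e m) (har : hammingNorm a ≤ r) : a = 0 := by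
  obtain ⟨f, hf, rfl⟩ := ha
  have := card_filter_eq_zero (projEval e m f)
  rw [eq_zero_of_projEval_eq_zero e hf (Finset.univ.filter fun i => projEval e m f i = 0)
    (by omega) (by simp), map_zero]

/-- Interpolation gives `f` of degree less than `r` that vanishes on the support of `b` except at
one point. Multiplying by `h` preserves this, and a single term of the product with `b` survives. -/
theorem exists_dotProduct_projRSMul_ne_zero (e : Fin n ≃ Option F) {h : F[X]} (hmon : h.Monic)
    (hroot : ∀ x, h.eval x ≠ 0) {r : ℕ} {b : Fin n → F} (hbr : hammingNorm b ≤ r) (hb : b ≠ 0) :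
    ∃ c ∈ projRSMul e h r (r + h.natDegree), b ⬝ᵥ c ≠ 0 := by
  obtain ⟨i, hi⟩ := Function.ne_iff.1 hb
  have hcard : ((Finset.univ.filter fun j => b j ≠ 0).erase i).card + 1 = hammingNorm b :=
    Finset.card_erase_add_one (by simpa using hi)
  obtain ⟨f, hf, hfi, hfj⟩ := exists_projEval_ne_zero e (m := r)
    ((Finset.univ.filter fun j => b j ≠ 0).erase i) (by omega) (Finset.notMem_erase i _)
  have hr : r ≠ 0 := by omega
  refine ⟨_, ⟨_, ⟨f, hf, rfl⟩, rfl⟩, ?_⟩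
  rw [dotProduct, Finset.sum_eq_single i]
  · rw [LinearMap.mulLeft_apply, projEval_mul e hmon hr hf]
    refine mul_ne_zero hi (mul_ne_zero ?_ hfi)
    cases e i with
    | none => exact one_ne_zero
    | some x => exact hroot x
  · intro j _ hj
    by_cases hbj : b j = 0
    · rw [hbj, zero_mul]
    · rw [LinearMap.mulLeft_apply, projEval_mul e hmon hr hf, hfj j (by simp [hj, hbj]), mul_zero,
        mul_zero]
  · simp

/-- The projective Reed-Solomon code of dimension `m` has a nonzero word of weight `n - m + 1`,
which is not a word of the proper subcode of multiples of `h`. -/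
theorem exists_mem_projRS (e : Fin n ≃ Option F) {h : F[X]} (hmon : h.Monic)
    (hroot : ∀ x, h.eval x ≠ 0) {r : ℕ} (hn : 2 * r + h.natDegree = n) (hn0 : n ≠ 0) :
    ∃ w ∈ projRS e (r + h.natDegree), w ≠ 0 ∧ hammingNorm w ≤ r + 1 ∧
      (h.natDegree ≠ 0 → w ∉ projRSMul e h r (r + h.natDegree)) := by
  -- A word vanishing at `r + h.natDegree - 1` positions has weight at most `n - (r + h.natDegree -
  -- 1) = r + 1`.
  obtain ⟨S, hS⟩ := Finset.exists_subset_card_eq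
    (s := (Finset.univ : Finset (Fin n))) (n := r + h.natDegree - 1) (by simp; omega)
  obtain ⟨i, hi⟩ : ∃ i, i ∉ S := by
    by_contra! hall
    have : S.card = n := by rw [Finset.eq_univ_of_forall hall, Finset.card_fin]
    omega
  obtain ⟨g, hg, hgi, hgS⟩ := exists_projEval_ne_zero e (m := r + h.natDegree) S (by omega) hi
  refine ⟨_, ⟨g, hg, rfl⟩, fun h0 => hgi (congrFun h0 i), ?_, ?_⟩
  · have h₁ := card_filter_eq_zero (projEval e (r + h.natDegree) g)
    have h₂ : S.card ≤ (Finset.univ.filter fun i => projEval e (r + h.natDegree) g i = 0).card :=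
      Finset.card_le_card fun j hj => by simpa using hgS j hj
    omega
  · rintro hd ⟨_, ⟨f, hf, rfl⟩, hfg⟩
    rw [LinearMap.mulLeft_apply] at hfg
    suffices f = 0 by
      rw [← hfg, this, mul_zero, map_zero] at hgi
      exact hgi rfl
    rcases eq_or_ne r 0 with rfl | hr
    · simpa [mem_degreeLT] using hf
    -- If the word came from `h * f`, then `f` would vanish on `S`, which has at least `r` points
    -- since `h` has positive degree.
    refine eq_zero_of_projEval_eq_zero e hf S (by omega) fun j hj => ?_
    have := hgS j hj
    rw [← hfg, projEval_mul e hmon hr hf] at this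
    refine (mul_eq_zero.1 this).resolve_left ?_
    cases e j with
    | none => exact one_ne_zero
    | some x => exact hroot x

end ProjectiveReedSolomon

/-! ### The polynomial without roots and the MDS codes -/

theorem exists_monic_natDegree_eq_forall_eval_ne_zero {F : Type*} [Field F] [Finite F]
    (hF : ringChar F ≠ 2) (t : ℕ) :
    ∃ h : Polynomial F, h.Monic ∧ h.natDegree = 2 * t ∧ ∀ x, h.eval x ≠ 0 := by
  obtain ⟨a, ha⟩ := FiniteField.exists_nonsquare hF
  have hmon : (Polynomial.X ^ 2 - Polynomial.C a).Monic :=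
    Polynomial.monic_X_pow_sub_C a two_ne_zero
  refine ⟨(Polynomial.X ^ 2 - Polynomial.C a) ^ t, hmon.pow t, ?_, fun x => ?_⟩
  · rw [hmon.natDegree_pow, Polynomial.natDegree_X_pow_sub_C, mul_comm]
  · rw [Polynomial.eval_pow]
    refine pow_ne_zero _ fun h => ha ⟨x, ?_⟩
    rw [← pow_two]
    exact (sub_eq_zero.1 (by simpa using h)).symm

theorem exists_isMDS (p : ℕ) [Fact p.Prime] {F : Type*} [Field F] [Fintype F] [DecidableEq F]
    [Algebra (ZMod p) F] {q : ℕ} (hodd : Odd q) (hF : Fintype.card F = q) {r k : ℕ}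
    (hk : 2 * r + k = q + 1) :
    ∃ Q : Submodule ℂ (StateSpace F (q + 1)), IsMDS p Q k (r + 1) := by
  have hchar : ringChar F ≠ 2 := fun h2 => by
    have := FiniteField.even_card_of_char_two h2
    rw [hF] at this
    have := Nat.odd_iff.1 hodd
    omega
  obtain ⟨t, rfl⟩ : ∃ t, k = 2 * t := ⟨(q + 1) / 2 - r, by obtain ⟨s, rfl⟩ := hodd; omega⟩
  obtain ⟨h, hmon, hdeg, hroot⟩ := exists_monic_natDegree_eq_forall_eval_ne_zero hchar t
  let e : Fin (q + 1) ≃ Option F := (Fintype.equivFinOfCardEq (by simp [hF])).symm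
  obtain ⟨w, hw, hw0, hwr, hw₂⟩ := exists_mem_projRS e hmon hroot (r := r) (by omega) (by omega)
  refine ⟨cssCode (projRS e (r + h.natDegree)) (projRSMul e h r (r + h.natDegree)),
    hasParameters_cssCode (projRSMul_le e le_rfl) ?_ (fun a ha har =>
      eq_zero_of_mem_projRS e (by omega) ha har)
      (fun b hbr hb => exists_dotProduct_projRSMul_ne_zero e hmon hroot hbr hb) hw hw0 hwr
      fun hk => hw₂ (hdeg ▸ hk), ?_⟩
  · rw [finrank_projRS e (by omega), finrank_projRSMul e hmon.ne_zero le_rfl (by omega), hdeg]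
  · push_cast
    omega

end QuantumCode

/-- The distance `q - k + 2` is written `q + 2 - k`, since `k = q + 1` is allowed. -/
theorem theorem3p4 (p e q : ℕ) [Fact p.Prime] (hq : q = p ^ e) (hodd : Odd q) (hq3 : 3 < q)
    (F : Type*) [Field F] [Fintype F] [DecidableEq F] [Algebra (ZMod p) F]
    (hF : Fintype.card F = q) :
    (∀ k : ℕ, ⌈((q : ℚ) + 2) / 2⌉₊ ≤ k → k ≤ q + 1 →
      ∃ Q : Submodule ℂ (QuantumCode.StateSpace F (q + 1)),
        QuantumCode.IsMDS p Q (2 * k - q - 1) (q + 2 - k)) ∧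
    ∃ Q : Submodule ℂ (QuantumCode.StateSpace F (q + 1)),
      QuantumCode.IsMDS p Q 0 ((q + 1) / 2 + 1) := by
  constructor
  · intro k hk hkq
    have hk' : q + 2 ≤ 2 * k := by
      have := Nat.ceil_le.1 hk
      rw [div_le_iff₀ two_pos] at this
      have : ((q + 2 : ℕ) : ℚ) ≤ ((2 * k : ℕ) : ℚ) := by push_cast; linarith
      exact_mod_cast this
    -- Here `r = q + 1 - k`, and `2 * r + (2 * k - q - 1) = q + 1`.
    rw [show q + 2 - k = (q + 1 - k) + 1 by omega]
    exact QuantumCode.exists_isMDS p hodd hF (by omega)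
  · refine QuantumCode.exists_isMDS p hodd hF ?_
    obtain ⟨s, rfl⟩ := hodd
    omega
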